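/- Let $\mathcal X,\mathcal Y,\mathcal Z,\mathcal U$ be finite or countably infinite sets with $|\mathcal U|\ge|\mathcal X|$. Let $\mathbf X=\{X^n\}_{n\ge1}$ be a general source, i.e. for each $n$ the random variable $X^n$ has an arbitrary law on $\mathcal X^n$ (no consistency between different $n$ is required). For each $n$ let $d_1^{(n)}:\mathcal X^n\times\mathcal Y^n\to[0,\infty)$ and $d_2^{(n)}:\mathcal X^n\times\mathcal Z^n\to[0,\infty)$ be arbitrary functions, and let $D_1,D_2\ge0$ be real numbers. For real random variables $S_n$ put $$\operatorname{p-}\limsup_{n\to\infty}S_n=\inf\{\alpha\in\mathbb R:\lim_{n\to\infty}\Pr\{S_n>\alpha\}=0\}\in[-\infty,\infty].$$ A code of blocklength $n$ consists of positive integers $M_1^{(n)},M_2^{(n)}$, encoders $f_i^{(n)}:\mathcal X^n\to\{1,\dots,M_i^{(n)}\}$ $(i=1,2)$ and decoders $\varphi_1^{(n)}:\{1,\dots,M_1^{(n)}\}\to\mathcal Y^n$, $\varphi_2^{(n)}:\{1,\dots,M_1^{(n)}\}\times\{1,\dots,M_2^{(n)}\}\to\mathcal Z^n$. The rate-distortion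 region $\mathcal R(D_1,D_2|\mathbf X)$ is the set of all pairs $(R_1,R_2)$ of non-negative real numbers for which there is a sequence of codes with $$\operatorname{p-}\limsup_{n\to\infty}d_1^{(n)}\bigl(X^n,\varphi_1^{(n)}(f_1^{(n)}(X^n))\bigr)\le D_1,\qquad \operatorname{p-}\limsup_{n\to\infty}d_2^{(n)}\bigl(X^n,\varphi_2^{(n)}(f_1^{(n)}(X^n),f_2^{(n)}(X^n))\bigr)\le D_2,$$ $$\limsup_{n\to\infty}\tfrac1n\log M_i^{(n)}\le R_i\qquad(i=1,2).$$ For sequences of discrete random variables define the spectral sup-mutual information rates $$\overline I(\mathbf A;\mathbf B)=\operatorname{p-}\limsup_{n\to\infty}\frac1n\log\frac{P_{B^n|A^n}(B^n|A^n)}{P_{B^n}(B^n)},\qquad \overline I(\mathbf A;\mathbf B|\mathbf C)=\operatorname{p-}\limsup_{n\to\infty}\frac1n\log\frac{P_{B^n|A^nC^n}(B^n|A^n,C^n)}{P_{B^n|C^n}(B^n|C^n)}.$$ Then $$\mathcal R(D_1,D_2|\mathbf X)=\bigcup_{\mathbf P_{\mathbf U\mathbf Y\mathbf Z|\mathbf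 X}}\bigl\{(R_1,R_2)\in\mathbb R^2: R_1\ge\overline I(\mathbf X;\mathbf U,\mathbf Y),\ R_2\ge\overline I(\mathbf X;\mathbf Z|\mathbf U,\mathbf Y)\bigr\},$$ where the union is over all sequences $\mathbf P_{\mathbf U\mathbf Y\mathbf Z|\mathbf X}=\{P_{U^nY^nZ^n|X^n}\}_{n\ge1}$ of conditional laws on $\mathcal U^n\times\mathcal Y^n\times\mathcal Z^n$ given $\mathcal X^n$ such that the induced random variables $(X^n,U^n,Y^n,Z^n)$ satisfy $$\operatorname{p-}\limsup_{n\to\infty}d_1^{(n)}(X^n,Y^n)\le D_1\qquad\text{and}\qquad\operatorname{p-}\limsup_{n\to\infty}d_2^{(n)}(X^n,Z^n)\le D_2.$$ -/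

import Mathlib

open Filter Topology
open scoped NNReal ENNReal

noncomputable section

namespace SuccessiveRefinement

universe u v w t

/-- The limit superior in probability of a sequence of real random variables `S n`, where `S n` is
defined on the discrete probability space `(Ω n, P n)`: the infimum of all real `α` with
`Pr {S n > α} → 0`. It takes values in the extended reals (`⊤` if there is no such `α`). -/
def pLimsup {Ω : ℕ → Type*} (P : ∀ n, PMF (Ω n)) (S : ∀ n, Ω n → ℝ) : EReal :=
  sInf ((fun α : ℝ => (α : EReal)) ''
    {α : ℝ | Tendsto (fun n => (P n).toOuterMeasure {ω | α < S n ω}) atTop (𝓝 0)})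

/-- The probability `P_B (b)` that the random variable `B` takes the value `b`. -/
def prob {Ω : Type*} {β : Type*} (P : PMF Ω) (B : Ω → β) (b : β) : ℝ :=
  (P.map B b).toReal

/-- The conditional probability `P_{B|A} (b | a) = P_{BA} (b, a) / P_A (a)`. -/
def condProb {Ω : Type*} {α β : Type*} (P : PMF Ω) (B : Ω → β) (A : Ω → α) (b : β) (a : α) : ℝ :=
  prob P (fun ω => (B ω, A ω)) (b, a) / prob P A a

/-- The spectral sup-mutual information rate of two sequences of random variables: the limit
superior in probability of `(1/n) log (P_{B|A} (B | A) / P_B (B))`. -/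
def supInfoRate {Ω α β : ℕ → Type*} (P : ∀ n, PMF (Ω n))
    (A : ∀ n, Ω n → α n) (B : ∀ n, Ω n → β n) : EReal :=
  pLimsup P fun n ω => (1 / (n : ℝ)) *
    Real.log (condProb (P n) (B n) (A n) (B n ω) (A n ω) / prob (P n) (B n) (B n ω))

/-- The spectral conditional sup-mutual information rate: the limit superior in probability of
`(1/n) log (P_{B|AC} (B | A, C) / P_{B|C} (B | C))`. -/
def supCondInfoRate {Ω α β γ : ℕ → Type*} (P : ∀ n, PMF (Ω n))
    (A : ∀ n, Ω n → α n) (B : ∀ n, Ω n → β n) (C : ∀ n, Ω n → γ n) : EReal :=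
  pLimsup P fun n ω => (1 / (n : ℝ)) *
    Real.log (condProb (P n) (B n) (fun ω' => (A n ω', C n ω')) (B n ω) (A n ω, C n ω) /
      condProb (P n) (B n) (C n) (B n ω) (C n ω))

/-- A general source: for each blocklength `n` an arbitrary law on `𝒳ⁿ`, without any consistency
between different `n`. The term `n = 0`, here and below, carries no information (`𝒳⁰` is a single
point) and does not influence any of the limits. -/
abbrev GeneralSource (𝒳 : Type u) : Type u := ∀ n : ℕ, PMF (Fin n → 𝒳)

/-- A sequence of arbitrary distortion measures `𝒳ⁿ × 𝒴ⁿ → [0, ∞)`. -/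
abbrev DistortionMeasures (𝒳 : Type u) (𝒴 : Type v) : Type (max u v) :=
  ∀ n : ℕ, (Fin n → 𝒳) → (Fin n → 𝒴) → ℝ≥0

/-- A code of blocklength `n`: two encoders of the source sequence, a decoder that sees the first
codeword and a decoder that sees both. -/
structure Code (𝒳 : Type u) (𝒴 : Type v) (𝒵 : Type w) (n : ℕ) where
  /-- number of codewords of encoder 1 -/
  M₁ : ℕ
  /-- number of codewords of encoder 2 -/
  M₂ : ℕ
  M₁_pos : 0 < M₁
  M₂_pos : 0 < M₂
  /-- encoder 1 -/
  f₁ : (Fin n → 𝒳) → Fin M₁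
  /-- encoder 2 -/
  f₂ : (Fin n → 𝒳) → Fin M₂
  /-- decoder 1 -/
  φ₁ : Fin M₁ → (Fin n → 𝒴)
  /-- decoder 2 -/
  φ₂ : Fin M₁ → Fin M₂ → (Fin n → 𝒵)

/-- The rate pair `(R₁, R₂)` with distortion levels `(D₁, D₂)` is achievable under the
maximum-distortion criterion. The upper limits of the rates are taken in the extended reals. -/
def FmAchievable {𝒳 : Type u} {𝒴 : Type v} {𝒵 : Type w} (X : GeneralSource 𝒳)
    (d₁ : DistortionMeasures 𝒳 𝒴) (d₂ : DistortionMeasures 𝒳 𝒵) (D₁ D₂ R₁ R₂ : ℝ) : Prop :=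
  ∃ c : ∀ n : ℕ, Code 𝒳 𝒴 𝒵 n,
    pLimsup X (fun n x => (d₁ n x ((c n).φ₁ ((c n).f₁ x)) : ℝ)) ≤ (D₁ : EReal) ∧
    pLimsup X (fun n x => (d₂ n x ((c n).φ₂ ((c n).f₁ x) ((c n).f₂ x)) : ℝ)) ≤ (D₂ : EReal) ∧
    limsup (fun n : ℕ => (((1 / (n : ℝ)) * Real.log ((c n).M₁ : ℝ) : ℝ) : EReal)) atTop
      ≤ (R₁ : EReal) ∧
    limsup (fun n : ℕ => (((1 / (n : ℝ)) * Real.log ((c n).M₂ : ℝ) : ℝ) : EReal)) atTop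
      ≤ (R₂ : EReal)

/-- The rate-distortion region: all achievable pairs of non-negative rates. -/
def rateDistortionRegion {𝒳 : Type u} {𝒴 : Type v} {𝒵 : Type w} (X : GeneralSource 𝒳)
    (d₁ : DistortionMeasures 𝒳 𝒴) (d₂ : DistortionMeasures 𝒳 𝒵) (D₁ D₂ : ℝ) : Set (ℝ × ℝ) :=
  {R | 0 ≤ R.1 ∧ 0 ≤ R.2 ∧ FmAchievable X d₁ d₂ D₁ D₂ R.1 R.2}

/-- A sequence of conditional laws of `(Uⁿ, Yⁿ, Zⁿ)` given `Xⁿ`. -/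
abbrev CondLaws (𝒳 : Type u) (𝒴 : Type v) (𝒵 : Type w) (𝒰 : Type t) : Type (max u v w t) :=
  ∀ n : ℕ, (Fin n → 𝒳) → PMF ((Fin n → 𝒰) × (Fin n → 𝒴) × (Fin n → 𝒵))

section Induced

variable {𝒳 : Type u} {𝒴 : Type v} {𝒵 : Type w} {𝒰 : Type t}

/-- The joint law of `(Xⁿ, Uⁿ, Yⁿ, Zⁿ)` induced by a source and a sequence of conditional laws. -/
def jointLaw (X : GeneralSource 𝒳) (W : CondLaws 𝒳 𝒴 𝒵 𝒰) (n : ℕ) :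
    PMF ((Fin n → 𝒳) × (Fin n → 𝒰) × (Fin n → 𝒴) × (Fin n → 𝒵)) :=
  (X n).bind fun x => (W n x).map fun uyz => (x, uyz)

/-- The sequences of conditional laws whose spectral sup-distortions are at most `D₁`, `D₂`. -/
def admissible (𝒰 : Type t) (X : GeneralSource 𝒳) (d₁ : DistortionMeasures 𝒳 𝒴)
    (d₂ : DistortionMeasures 𝒳 𝒵) (D₁ D₂ : ℝ) : Set (CondLaws 𝒳 𝒴 𝒵 𝒰) :=
  {W | pLimsup (jointLaw X W) (fun n ω => (d₁ n ω.1 ω.2.2.1 : ℝ)) ≤ (D₁ : EReal) ∧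
    pLimsup (jointLaw X W) (fun n ω => (d₂ n ω.1 ω.2.2.2 : ℝ)) ≤ (D₂ : EReal)}

/-- All real pairs with `R₁ ≥ Ī(X; U, Y)` and `R₂ ≥ Ī(X; Z | U, Y)`. -/
def generalRegion (X : GeneralSource 𝒳) (W : CondLaws 𝒳 𝒴 𝒵 𝒰) : Set (ℝ × ℝ) :=
  {R | supInfoRate (jointLaw X W) (fun _ ω => ω.1) (fun _ ω => (ω.2.1, ω.2.2.1))
        ≤ (R.1 : EReal) ∧
    supCondInfoRate (jointLaw X W) (fun _ ω => ω.1) (fun _ ω => ω.2.2.2)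
        (fun _ ω => (ω.2.1, ω.2.2.1))
        ≤ (R.2 : EReal)}

end Induced

end SuccessiveRefinement

end

/-!
Both inclusions between the operational region and the union of the information-spectrum regions
are proved from one-shot bounds at a fixed blocklength.

*Achievability.* Draw `M₁` cloud centres `(u, y)` and around each of them `M₂` satellites `z`.
`soft_covering` bounds the probability that all of `M` independent draws from `r` fail by the failure
probability under a target law `W` plus `exp (-M / K)`, provided `W ≤ K r` wherever failure is not
certain. Because it allows failure to be a probability and not just an event, it applies first to
the satellites of one centre and then to the centres, whose failure probability is the one just
bounded (`exists_superposition_codebook`). The random codebook is replaced by a deterministic one by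
fixing the codewords one after the other, each no worse than the average (`exists_tsum_mul_prod_le`);
this avoids product measures. With `K` the exponential of `n (R + γ)` and `M` that of `n (R + 2 γ)`,
the excess probability is controlled by the tails in the definition of the limit superior in
probability (`exists_code`), and a diagonal choice of `γ` tending to zero with `n` gives rates and
distortions without slack (`exists_tendsto_diagonal`).

*Converse.* Given codes, let `U` be the image under an embedding of a source sequence that represents
the first codeword. Then `(U, Y)` takes at most `M₁` values, and given `(U, Y)` the reconstruction
`Z` takes at most `M₂` values. A variable with at most `M` values takes a value of mass at most `δ`
with probability at most `M δ` (`IsCondLaw.toOuterMeasure_le_natCast_mul`), which bounds the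
spectral rates by the code rates (`pLimsup_infoDensity_le`).

Spectral rates are non-negative, as a likelihood ratio is at most `δ` with probability at most `δ`
(`nonneg_of_pLimsup_infoDensity_le`), so the union contains only pairs of non-negative rates.
-/

namespace SuccessiveRefinement

/-! ### Limit superior in probability -/

lemma pLimsup_le_iff {Ω : ℕ → Type*} {P : ∀ n, PMF (Ω n)} {S : ∀ n, Ω n → ℝ} {c : ℝ} :
    pLimsup P S ≤ (c : EReal) ↔
      ∀ γ > 0, Tendsto (fun n => (P n).toOuterMeasure {ω | c + γ < S n ω}) atTop (𝓝 0) := by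
  constructor
  · intro h γ hγ
    have hlt : pLimsup P S < ((c + γ : ℝ) : EReal) :=
      h.trans_lt (EReal.coe_lt_coe_iff.2 (by linarith))
    obtain ⟨_, ⟨α, hα, rfl⟩, hlt⟩ := sInf_lt_iff.1 hlt
    have hα' : α < c + γ := EReal.coe_lt_coe_iff.1 hlt
    exact tendsto_of_tendsto_of_tendsto_of_le_of_le tendsto_const_nhds hα (fun _ => zero_le)
      fun n => (P n).toOuterMeasure.mono fun ω hω => hα'.trans hω
  · intro h
    refine EReal.le_of_forall_lt_iff_le.1 fun z hz => ?_
    have hz' : 0 < z - c := sub_pos.2 (EReal.coe_lt_coe_iff.1 hz)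
    exact sInf_le ⟨z, by simpa using h (z - c) hz', rfl⟩

/-! ### Conditional laws on discrete spaces -/

section Conditional

variable {Ω α β γ : Type*}

lemma tsum_map_pair_left (P : PMF Ω) (B : Ω → β) (A : Ω → α) (a : α) :
    ∑' b, P.map (fun ω => (B ω, A ω)) (b, a) = P.map A a := by
  classical
  have h : P.map A = (P.map fun ω => (B ω, A ω)).map Prod.snd := by
    rw [PMF.map_comp]; rfl
  rw [h, PMF.map_apply, ENNReal.tsum_prod']
  refine tsum_congr fun b => ?_
  rw [tsum_eq_single a]
  · simp
  · intro a' ha'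
    simp [Ne.symm ha']

/-- `κ` is a version of the conditional law of `B` given `A` under `P`; it is unconstrained at the
values of `A` of probability zero. -/
def IsCondLaw (P : PMF Ω) (B : Ω → β) (A : Ω → α) (κ : α → PMF β) : Prop :=
  ∀ a b, P.map (fun ω => (B ω, A ω)) (b, a) = P.map A a * κ a b

lemma exists_isCondLaw (P : PMF Ω) (B : Ω → β) (A : Ω → α) : ∃ κ, IsCondLaw P B A κ := by
  classical
  have hne : ∀ a, P.map A a ≠ 0 → ∑' b, P.map (fun ω => (B ω, A ω)) (b, a) ≠ 0 := by
    intro a ha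
    rwa [tsum_map_pair_left]
  have htop : ∀ a, ∑' b, P.map (fun ω => (B ω, A ω)) (b, a) ≠ ∞ := by
    intro a
    rw [tsum_map_pair_left]
    exact PMF.apply_ne_top _ _
  refine ⟨fun a => if h : P.map A a = 0 then P.map B else
    PMF.normalize (fun b => P.map (fun ω => (B ω, A ω)) (b, a)) (hne a h) (htop a), ?_⟩
  intro a b
  by_cases h : P.map A a = 0
  · have h0 : ∑' b, P.map (fun ω => (B ω, A ω)) (b, a) = 0 := by rw [tsum_map_pair_left, h]
    rw [ENNReal.tsum_eq_zero.1 h0 b, h, zero_mul]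
  · beta_reduce
    rw [dif_neg h, PMF.normalize_apply, tsum_map_pair_left, mul_left_comm,
      ENNReal.mul_inv_cancel h (PMF.apply_ne_top _ _), mul_one]

lemma map_apply_ne_zero (P : PMF Ω) (A : Ω → α) {ω : Ω} (h : ω ∈ P.support) :
    P.map A (A ω) ≠ 0 :=
  (PMF.mem_support_iff _ _).1 ((PMF.mem_support_map_iff _ _ _).2 ⟨ω, h, rfl⟩)

lemma IsCondLaw.condProb_eq {P : PMF Ω} {B : Ω → β} {A : Ω → α} {κ : α → PMF β}
    (h : IsCondLaw P B A κ) {a : α} (ha : P.map A a ≠ 0) (b : β) :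
    condProb P B A b a = (κ a b).toReal := by
  have ha' : (P.map A a).toReal ≠ 0 :=
    ENNReal.toReal_ne_zero.2 ⟨ha, PMF.apply_ne_top _ _⟩
  rw [condProb, prob, prob, h a b, ENNReal.toReal_mul, mul_div_cancel_left₀ _ ha']

lemma IsCondLaw.apply_ne_zero {P : PMF Ω} {B : Ω → β} {A : Ω → α} {κ : α → PMF β}
    (h : IsCondLaw P B A κ) {ω : Ω} (hω : ω ∈ P.support) : κ (A ω) (B ω) ≠ 0 := by
  intro h0
  have := map_apply_ne_zero P (fun ω => (B ω, A ω)) hω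
  rw [h, h0, mul_zero] at this
  exact this rfl

lemma toOuterMeasure_preimage_eq (P : PMF Ω) (A : Ω → α) (T : Set α) :
    P.toOuterMeasure {ω | A ω ∈ T} = ∑' a, P.map A a * T.indicator 1 a := by
  change P.toOuterMeasure (A ⁻¹' T) = _
  rw [← PMF.toOuterMeasure_map_apply, PMF.toOuterMeasure_apply]
  refine tsum_congr fun a => ?_
  by_cases h : a ∈ T <;> simp [h]

lemma IsCondLaw.tsum_mul {P : PMF Ω} {B : Ω → β} {A : Ω → α} {κ : α → PMF β}
    (h : IsCondLaw P B A κ) (g : β × α → ℝ≥0∞) :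
    ∑' t, P.map (fun ω => (B ω, A ω)) t * g t = ∑' a, P.map A a * ∑' b, κ a b * g (b, a) := by
  rw [ENNReal.tsum_prod', ENNReal.tsum_comm]
  refine tsum_congr fun a => ?_
  rw [← ENNReal.tsum_mul_left]
  exact tsum_congr fun b => by rw [h, mul_assoc]

end Conditional

/-! ### Covering by a random codebook -/

/-- If `q ≤ K t`, the failure probability `s = 1 - t` of one draw drops after `M` draws to at most
`(1 - q) + exp (-M / K)`. -/
lemma pow_le_add_exp {s t q q' K : ℝ} (hs : 0 ≤ s) (hst : s + t = 1) (hq : 0 ≤ q) (hq' : 0 ≤ q')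
    (hqq : q + q' = 1) (hK : 1 ≤ K) (h : q ≤ K * t) (M : ℕ) :
    s ^ M ≤ q' + Real.exp (-(M / K)) := by
  have hK0 : 0 < K := by linarith
  have hy : 0 ≤ 1 - 1 / K := by
    rw [sub_nonneg, div_le_one hK0]; exact hK
  have hqt : q / K ≤ t := by rw [div_le_iff₀ hK0]; linarith
  have hs1 : s ≤ q' * 1 + q * (1 - 1 / K) := by
    have : q * (1 - 1 / K) = q - q / K := by ring
    rw [this]; linarith
  have hconv := (convexOn_pow M).2 (Set.mem_Ici.2 (zero_le_one' ℝ)) (Set.mem_Ici.2 hy) hq' hq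
    (by linarith)
  simp only [smul_eq_mul, one_pow, mul_one] at hconv
  have hexp : (1 - 1 / K) ^ M ≤ Real.exp (-(M / K)) := by
    calc (1 - 1 / K) ^ M ≤ Real.exp (-(1 / K)) ^ M :=
          pow_le_pow_left₀ hy (Real.one_sub_le_exp_neg _) M
      _ = Real.exp (-(M / K)) := by rw [← Real.exp_nat_mul]; congr 1; ring
  calc s ^ M ≤ (q' * 1 + q * (1 - 1 / K)) ^ M := pow_le_pow_left₀ hs hs1 M
    _ ≤ q' + q * (1 - 1 / K) ^ M := by simpa using hconv
    _ ≤ q' + 1 * Real.exp (-(M / K)) := by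
        gcongr
        linarith
    _ = _ := by rw [one_mul]

lemma tsum_mul_add_tsum_mul_one_sub {β : Type*} (r : PMF β) {φ : β → ℝ≥0∞} (hφ : ∀ v, φ v ≤ 1) :
    ∑' v, r v * φ v + ∑' v, r v * (1 - φ v) = 1 := by
  rw [← ENNReal.tsum_add]
  refine Eq.trans (tsum_congr fun v => ?_) r.tsum_coe
  rw [← mul_add, add_tsub_cancel_of_le (hφ v), mul_one]

/-- A soft covering bound. Draw `M` codewords independently from `r`, where a codeword `v` fails
with probability `φ v`. If `W ≤ K r` wherever failure is not certain, all codewords fail with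
probability at most the failure probability of one draw from `W`, plus `exp (-M / K)`. -/
lemma soft_covering {β : Type*} (W r : PMF β) {φ : β → ℝ≥0∞} (hφ : ∀ v, φ v ≤ 1) {K : ℝ}
    (hK : 1 ≤ K) (h : ∀ v, φ v = 1 ∨ W v ≤ ENNReal.ofReal K * r v) (M : ℕ) :
    (∑' v, r v * φ v) ^ M ≤ ∑' v, W v * φ v + ENNReal.ofReal (Real.exp (-(M / K))) := by
  have hr := tsum_mul_add_tsum_mul_one_sub r hφ
  have hW := tsum_mul_add_tsum_mul_one_sub W hφ
  have hq : ∑' v, W v * (1 - φ v) ≤ ENNReal.ofReal K * ∑' v, r v * (1 - φ v) := by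
    rw [← ENNReal.tsum_mul_left]
    refine ENNReal.tsum_le_tsum fun v => ?_
    rcases h v with h | h
    · simp [h]
    · rw [← mul_assoc]; gcongr
  set s := ∑' v, r v * φ v
  set t := ∑' v, r v * (1 - φ v)
  set q' := ∑' v, W v * φ v
  set q := ∑' v, W v * (1 - φ v)
  have hs : s ≠ ∞ := ne_top_of_le_ne_top ENNReal.one_ne_top (hr ▸ le_self_add)
  have ht : t ≠ ∞ := ne_top_of_le_ne_top ENNReal.one_ne_top (hr ▸ le_add_self)
  have hq' : q' ≠ ∞ := ne_top_of_le_ne_top ENNReal.one_ne_top (hW ▸ le_self_add)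
  have hq0 : q ≠ ∞ := ne_top_of_le_ne_top ENNReal.one_ne_top (hW ▸ le_add_self)
  have key := pow_le_add_exp (s := s.toReal) (t := t.toReal) (q := q.toReal) (q' := q'.toReal)
    ENNReal.toReal_nonneg (by rw [← ENNReal.toReal_add hs ht, hr, ENNReal.toReal_one])
    ENNReal.toReal_nonneg ENNReal.toReal_nonneg
    (by rw [add_comm, ← ENNReal.toReal_add hq' hq0, hW, ENNReal.toReal_one]) hK
    (by
      have := ENNReal.toReal_mono (ENNReal.mul_ne_top ENNReal.ofReal_ne_top ht) hq
      rwa [ENNReal.toReal_mul, ENNReal.toReal_ofReal (by linarith)] at this) M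
  rw [← ENNReal.ofReal_toReal hs, ← ENNReal.ofReal_toReal hq',
    ← ENNReal.ofReal_pow ENNReal.toReal_nonneg,
    ← ENNReal.ofReal_add ENNReal.toReal_nonneg (Real.exp_nonneg _)]
  exact ENNReal.ofReal_le_ofReal key

lemma exists_le_tsum_mul {β : Type*} (r : PMF β) (F : β → ℝ≥0∞) :
    ∃ b, F b ≤ ∑' b, r b * F b := by
  by_contra! hlt
  obtain ⟨b₀, hb₀⟩ := r.support_nonempty
  have hne : ∑' b, r b * F b ≠ ∞ := (hlt b₀).ne_top
  have : ∑' b, r b * ∑' b, r b * F b < ∑' b, r b * F b := by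
    refine ENNReal.tsum_lt_tsum (i := b₀) ?_ (fun b => by gcongr; exact (hlt b).le) ?_
    · rwa [ENNReal.tsum_mul_right, r.tsum_coe, one_mul]
    · exact ENNReal.mul_lt_mul_right ((PMF.mem_support_iff _ _).1 hb₀) (PMF.apply_ne_top _ _)
        (hlt b₀)
  rw [ENNReal.tsum_mul_right, r.tsum_coe, one_mul] at this
  exact this.false

/-- Derandomisation of independent draws `b i ∼ μ i`: some realisation does at least as well as the
average. The draws are fixed one at a time, so that no product measure is needed. -/
lemma exists_tsum_mul_prod_le {α β ι : Type*} (s : Finset ι) (μ : ι → PMF β)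
    (w : ι → α → β → ℝ≥0∞) (p : α → ℝ≥0∞) :
    ∃ b : ι → β, ∑' a, p a * ∏ i ∈ s, w i a (b i) ≤
      ∑' a, p a * ∏ i ∈ s, ∑' v, μ i v * w i a v := by
  classical
  induction s using Finset.induction_on generalizing p with
  | empty => exact ⟨fun i => (μ i).support_nonempty.some, by simp⟩
  | insert i s hi ih =>
    obtain ⟨v, hv⟩ := exists_le_tsum_mul (μ i)
      fun v => ∑' a, p a * w i a v * ∏ j ∈ s, ∑' v, μ j v * w j a v
    obtain ⟨b, hb⟩ := ih fun a => p a * w i a v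
    refine ⟨Function.update b i v, ?_⟩
    have h1 : ∀ a, ∏ j ∈ s, w j a (Function.update b i v j) = ∏ j ∈ s, w j a (b j) := fun a =>
      Finset.prod_congr rfl fun j hj => by
        rw [Function.update_of_ne (ne_of_mem_of_not_mem hj hi)]
    simp only [Finset.prod_insert hi, Function.update_self, h1, ← mul_assoc]
    refine (hb.trans hv).trans (le_of_eq ?_)
    rw [tsum_congr fun v => ENNReal.tsum_mul_left.symm, ENNReal.tsum_comm]
    refine tsum_congr fun a => ?_
    rw [← ENNReal.tsum_mul_left, ← ENNReal.tsum_mul_right]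
    exact tsum_congr fun v => by ring

/-- One-shot superposition coding: `M₁` cloud centres `v i`, drawn from `r`, and around each of them
`M₂` satellites `z i j`, drawn from `κ (v i)`. -/
lemma exists_superposition_codebook {α β γ : Type*} (p : PMF α) (W : α → PMF β)
    (κ' : α × β → PMF γ) (r : PMF β) (κ : β → PMF γ) (T : Set (γ × α × β)) {K₁ K₂ : ℝ}
    (hK₁ : 1 ≤ K₁) (hK₂ : 1 ≤ K₂)
    (hT : ∀ a v z, (z, a, v) ∈ T →
      W a v ≤ ENNReal.ofReal K₁ * r v ∧ κ' (a, v) z ≤ ENNReal.ofReal K₂ * κ v z)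
    (M₁ M₂ : ℕ) :
    ∃ (v : Fin M₁ → β) (z : Fin M₁ → Fin M₂ → γ),
      p.toOuterMeasure {a | ∀ i j, (z i j, a, v i) ∉ T} ≤
        ∑' a, p a * ∑' v, W a v * ∑' z, κ' (a, v) z * Tᶜ.indicator 1 (z, a, v) +
          ENNReal.ofReal (Real.exp (-(M₁ / K₁))) + ENNReal.ofReal (Real.exp (-(M₂ / K₂))) := by
  classical
  -- `s a v` is the probability that one satellite of the cloud centre `v` fails for `a`
  set s : α → β → ℝ≥0∞ := fun a v => ∑' z, κ v z * Tᶜ.indicator 1 (z, a, v) with hs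
  have hind : ∀ t, Tᶜ.indicator (1 : γ × α × β → ℝ≥0∞) t ≤ 1 := fun t =>
    Set.indicator_apply_le' (fun _ => le_rfl) fun _ => zero_le_one
  have hs1 : ∀ a v, s a v ≤ 1 := fun a v =>
    calc s a v ≤ ∑' z, κ v z * 1 := ENNReal.tsum_le_tsum fun z => by gcongr; exact hind _
      _ = 1 := by simp [(κ v).tsum_coe]
  obtain ⟨v, hv⟩ := exists_tsum_mul_prod_le (Finset.univ : Finset (Fin M₁)) (fun _ => r)
    (fun _ a v => s a v ^ M₂) p
  obtain ⟨z, hz⟩ := exists_tsum_mul_prod_le (Finset.univ : Finset (Fin M₁ × Fin M₂))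
    (fun ij => κ (v ij.1)) (fun ij a z => Tᶜ.indicator 1 (z, a, v ij.1)) p
  refine ⟨v, fun i j => z (i, j), ?_⟩
  have hfail : p.toOuterMeasure {a | ∀ i j, (z (i, j), a, v i) ∉ T} ≤
      ∑' a, p a * ∏ ij : Fin M₁ × Fin M₂, Tᶜ.indicator 1 (z ij, a, v ij.1) := by
    rw [PMF.toOuterMeasure_apply]
    refine ENNReal.tsum_le_tsum fun a => ?_
    refine Set.indicator_apply_le' (fun ha => ?_) fun _ => zero_le
    rw [Finset.prod_eq_one, mul_one]
    intro ij _
    exact Set.indicator_of_mem (s := Tᶜ) (ha ij.1 ij.2) _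
  have hsat : ∀ a v, s a v ^ M₂ ≤ ∑' z, κ' (a, v) z * Tᶜ.indicator 1 (z, a, v) +
      ENNReal.ofReal (Real.exp (-(M₂ / K₂))) := by
    intro a v
    refine soft_covering (κ' (a, v)) (κ v) (fun z => hind _) hK₂ (fun z => ?_) M₂
    by_cases h : (z, a, v) ∈ T
    · exact Or.inr (hT a v z h).2
    · exact Or.inl (Set.indicator_of_mem (s := Tᶜ) h _)
  have hcloud : ∀ a, (∑' v, r v * s a v ^ M₂) ^ M₁ ≤
      ∑' v, W a v * ∑' z, κ' (a, v) z * Tᶜ.indicator 1 (z, a, v) +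
        ENNReal.ofReal (Real.exp (-(M₁ / K₁))) + ENNReal.ofReal (Real.exp (-(M₂ / K₂))) := by
    intro a
    refine (soft_covering (W a) r (fun v => pow_le_one₀ zero_le (hs1 a v)) hK₁ (fun v => ?_)
      M₁).trans ?_
    · by_cases h : ∃ z, (z, a, v) ∈ T
      · obtain ⟨z, hz⟩ := h
        exact Or.inr (hT a v z hz).1
      · push Not at h
        refine Or.inl ?_
        have : s a v = 1 := by
          rw [← (κ v).tsum_coe]
          exact tsum_congr fun z => by
            rw [Set.indicator_of_mem (s := Tᶜ) (h z), Pi.one_apply, mul_one]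
        rw [this, one_pow]
    · rw [add_right_comm]
      gcongr
      calc ∑' v, W a v * s a v ^ M₂
          ≤ ∑' v, (W a v * ∑' z, κ' (a, v) z * Tᶜ.indicator 1 (z, a, v) +
              W a v * ENNReal.ofReal (Real.exp (-(M₂ / K₂)))) :=
            ENNReal.tsum_le_tsum fun v => by rw [← mul_add]; gcongr; exact hsat a v
        _ = _ := by rw [ENNReal.tsum_add, ENNReal.tsum_mul_right, (W a).tsum_coe, one_mul]
  have hprod : ∀ a, ∏ ij : Fin M₁ × Fin M₂, ∑' z, κ (v ij.1) z * Tᶜ.indicator 1 (z, a, v ij.1) =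
      ∏ i, s a (v i) ^ M₂ := by
    intro a
    rw [Fintype.prod_prod_type]
    simp [hs]
  simp only [hprod] at hz
  refine (hfail.trans hz).trans (hv.trans ?_)
  simp only [Finset.prod_const, Finset.card_univ, Fintype.card_fin]
  calc ∑' a, p a * (∑' v, r v * s a v ^ M₂) ^ M₁
      ≤ ∑' a, (p a * ∑' v, W a v * ∑' z, κ' (a, v) z * Tᶜ.indicator 1 (z, a, v) +
          p a * ENNReal.ofReal (Real.exp (-(M₁ / K₁))) +
          p a * ENNReal.ofReal (Real.exp (-(M₂ / K₂)))) :=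
        ENNReal.tsum_le_tsum fun a => by rw [← mul_add, ← mul_add]; gcongr; exact hcloud a
    _ = _ := by
      rw [ENNReal.tsum_add, ENNReal.tsum_add, ENNReal.tsum_mul_right, ENNReal.tsum_mul_right,
        p.tsum_coe, one_mul, one_mul]

/-- Superposition coding matched to the joint law of `(A, V, C)`: the probability that no pair of
codewords is good for `A` is bounded by the probabilities that `(C, A, V)` is not good or that one
of the two likelihood ratios exceeds its threshold, up to two exponential terms. -/
lemma exists_codebook {Ω α β γ : Type*} (P : PMF Ω) (A : Ω → α) (V : Ω → β) (C : Ω → γ)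
    (G : Set (γ × α × β)) {K₁ K₂ : ℝ} (hK₁ : 1 ≤ K₁) (hK₂ : 1 ≤ K₂) (M₁ M₂ : ℕ) :
    ∃ (v : Fin M₁ → β) (z : Fin M₁ → Fin M₂ → γ),
      (P.map A).toOuterMeasure {a | ∀ i j, (z i j, a, v i) ∉ G} ≤
        P.toOuterMeasure {ω | (C ω, A ω, V ω) ∉ G} +
        P.toOuterMeasure {ω | K₁ < condProb P V A (V ω) (A ω) / prob P V (V ω)} +
        P.toOuterMeasure {ω | K₂ < condProb P C (fun ω' => (A ω', V ω')) (C ω) (A ω, V ω) /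
          condProb P C V (C ω) (V ω)} +
        ENNReal.ofReal (Real.exp (-(M₁ / K₁))) + ENNReal.ofReal (Real.exp (-(M₂ / K₂))) := by
  classical
  obtain ⟨W, hW⟩ := exists_isCondLaw P V A
  obtain ⟨κ', hκ'⟩ := exists_isCondLaw P C fun ω => (A ω, V ω)
  obtain ⟨κ, hκ⟩ := exists_isCondLaw P C V
  set T : Set (γ × α × β) := {t | t ∈ G ∧
    W t.2.1 t.2.2 ≤ ENNReal.ofReal K₁ * P.map V t.2.2 ∧
    κ' t.2 t.1 ≤ ENNReal.ofReal K₂ * κ t.2.2 t.1} with hT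
  obtain ⟨v, z, h⟩ := exists_superposition_codebook (P.map A) W κ' (P.map V) κ T hK₁ hK₂
    (fun a v z h => h.2) M₁ M₂
  refine ⟨v, z, ((MeasureTheory.OuterMeasure.mono _ ?_).trans h).trans ?_⟩
  · exact fun a ha i j hmem => ha i j hmem.1
  gcongr
  have hswap : ∀ a v, P.map (fun ω => (A ω, V ω)) (a, v) = P.map A a * W a v := by
    intro a v
    rw [← hW a v, PMF.map_apply, PMF.map_apply]
    refine tsum_congr fun ω => ?_
    simp only [Prod.mk.injEq, and_comm]
  have hsum : ∑' a, P.map A a * ∑' v, W a v * ∑' z, κ' (a, v) z * Tᶜ.indicator 1 (z, a, v) =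
      P.toOuterMeasure {ω | (C ω, A ω, V ω) ∈ Tᶜ} := by
    rw [toOuterMeasure_preimage_eq P (fun ω => (C ω, A ω, V ω)) Tᶜ, hκ'.tsum_mul,
      ENNReal.tsum_prod']
    refine tsum_congr fun a => ?_
    rw [← ENNReal.tsum_mul_left]
    exact tsum_congr fun v => by rw [hswap, mul_assoc]
  rw [hsum]
  refine le_trans ?_ ((MeasureTheory.measure_union_le _ _).trans
    (add_le_add_left (MeasureTheory.measure_union_le _ _) _))
  refine PMF.toOuterMeasure_mono _ ?_
  rintro ω ⟨hω, hsupp⟩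
  by_contra hcon
  simp only [Set.mem_union, Set.mem_ofPred_eq, not_or, not_lt, not_not] at hcon
  obtain ⟨⟨hG, h1⟩, h2⟩ := hcon
  -- on the support of `P` all masses are positive, so bounded ratios are bounds between masses
  have key : ∀ {x y : ℝ≥0∞} {K : ℝ}, 1 ≤ K → x ≠ ∞ → y ≠ 0 → y ≠ ∞ →
      x.toReal / y.toReal ≤ K → x ≤ ENNReal.ofReal K * y := by
    intro x y K hK hx hy0 hy h
    rw [div_le_iff₀ (ENNReal.toReal_pos hy0 hy)] at h
    rw [← ENNReal.ofReal_toReal hx, ← ENNReal.ofReal_toReal hy,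
      ← ENNReal.ofReal_mul (by linarith)]
    exact ENNReal.ofReal_le_ofReal h
  refine hω ⟨hG, ?_, ?_⟩
  · rw [hW.condProb_eq (map_apply_ne_zero P A hsupp), prob] at h1
    exact key hK₁ (PMF.apply_ne_top _ _) (map_apply_ne_zero P V hsupp) (PMF.apply_ne_top _ _) h1
  · rw [hκ'.condProb_eq (map_apply_ne_zero P (fun ω => (A ω, V ω)) hsupp),
      hκ.condProb_eq (map_apply_ne_zero P V hsupp)] at h2
    exact key hK₂ (PMF.apply_ne_top _ _) (hκ.apply_ne_zero hsupp) (PMF.apply_ne_top _ _) h2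

/-! ### Achievability -/

section Achievability

variable {𝒳 𝒴 𝒵 𝒰 : Type*}

lemma map_fst_jointLaw (X : GeneralSource 𝒳) (W : CondLaws 𝒳 𝒴 𝒵 𝒰) (n : ℕ) :
    (jointLaw X W n).map Prod.fst = X n := by
  rw [jointLaw, PMF.map_bind]
  refine Eq.trans (congrArg _ (funext fun x => ?_)) (PMF.bind_pure (X n))
  rw [PMF.map_comp]
  exact PMF.map_const _ _

lemma log_natCeil_exp_le {n : ℕ} (hn : n ≠ 0) {r : ℝ} (hr : 0 ≤ r) :
    1 / (n : ℝ) * Real.log (⌈Real.exp (n * r)⌉₊ : ℝ) ≤ r + Real.log 2 / n := by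
  have hn' : (0 : ℝ) < n := by positivity
  have h1 : 1 ≤ Real.exp (n * r) := Real.one_le_exp (by positivity)
  have h2 : (⌈Real.exp (n * r)⌉₊ : ℝ) ≤ 2 * Real.exp (n * r) :=
    (Nat.ceil_lt_add_one (by positivity)).le.trans (by linarith)
  have h3 : Real.log (⌈Real.exp (n * r)⌉₊ : ℝ) ≤ Real.log 2 + n * r := by
    refine (Real.log_le_log (Nat.cast_pos.2 (Nat.ceil_pos.2 (Real.exp_pos _))) h2).trans
      (le_of_eq ?_)
    rw [Real.log_mul two_ne_zero (Real.exp_ne_zero _), Real.log_exp]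
  calc 1 / (n : ℝ) * Real.log (⌈Real.exp (n * r)⌉₊ : ℝ)
      ≤ 1 / (n : ℝ) * (Real.log 2 + n * r) := by gcongr
    _ = r + Real.log 2 / n := by field_simp; ring

lemma exp_neg_natCeil_div_le (n : ℕ) (R γ : ℝ) :
    Real.exp (-((⌈Real.exp (n * (R + 2 * γ))⌉₊ : ℝ) / Real.exp (n * (R + γ)))) ≤
      Real.exp (-Real.exp (n * γ)) := by
  refine Real.exp_le_exp.2 (neg_le_neg ?_)
  rw [le_div_iff₀ (Real.exp_pos _), ← Real.exp_add]
  refine le_trans (le_of_eq ?_) (Nat.le_ceil _)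
  congr 1; ring

/-- The bound on the probability of excess distortion reached at blocklength `n` with slack `γ`: the
tails of the two distortions and of the two information densities, and the two covering terms. -/
noncomputable def excessBound (X : GeneralSource 𝒳) (d₁ : DistortionMeasures 𝒳 𝒴)
    (d₂ : DistortionMeasures 𝒳 𝒵) (D₁ D₂ R₁ R₂ : ℝ) (W : CondLaws 𝒳 𝒴 𝒵 𝒰) (γ : ℝ) (n : ℕ) : ℝ≥0∞ :=
  (jointLaw X W n).toOuterMeasure {ω | D₁ + γ < d₁ n ω.1 ω.2.2.1} +
  (jointLaw X W n).toOuterMeasure {ω | D₂ + γ < d₂ n ω.1 ω.2.2.2} +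
  (jointLaw X W n).toOuterMeasure {ω | R₁ + γ < (1 / (n : ℝ)) *
    Real.log (condProb (jointLaw X W n) (fun ω => (ω.2.1, ω.2.2.1)) (fun ω => ω.1)
      (ω.2.1, ω.2.2.1) ω.1 /
      prob (jointLaw X W n) (fun ω => (ω.2.1, ω.2.2.1)) (ω.2.1, ω.2.2.1))} +
  (jointLaw X W n).toOuterMeasure {ω | R₂ + γ < (1 / (n : ℝ)) *
    Real.log (condProb (jointLaw X W n) (fun ω => ω.2.2.2) (fun ω => (ω.1, ω.2.1, ω.2.2.1))
      ω.2.2.2 (ω.1, ω.2.1, ω.2.2.1) /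
      condProb (jointLaw X W n) (fun ω => ω.2.2.2) (fun ω => (ω.2.1, ω.2.2.1))
        ω.2.2.2 (ω.2.1, ω.2.2.1))} +
  ENNReal.ofReal (Real.exp (-Real.exp (n * γ))) + ENNReal.ofReal (Real.exp (-Real.exp (n * γ)))

lemma lt_one_div_mul_log_of_exp_lt {n : ℕ} (hn : n ≠ 0) {r x : ℝ} (h : Real.exp (n * r) < x) :
    r < 1 / (n : ℝ) * Real.log x := by
  have hn' : (0 : ℝ) < n := by positivity
  have := (Real.lt_log_iff_exp_lt ((Real.exp_pos _).trans h)).2 h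
  rw [one_div, inv_mul_eq_div, lt_div_iff₀ hn']
  linarith

/-- At blocklength `n` and slack `γ`, some code has excess probability at most `excessBound` and
rates at most `R₁ + 2 γ` and `R₂ + 2 γ`, up to the rounding term `log 2 / n`. -/
lemma exists_code (X : GeneralSource 𝒳) (d₁ : DistortionMeasures 𝒳 𝒴)
    (d₂ : DistortionMeasures 𝒳 𝒵) (D₁ D₂ : ℝ) {R₁ R₂ : ℝ} (hR₁ : 0 ≤ R₁) (hR₂ : 0 ≤ R₂)
    (W : CondLaws 𝒳 𝒴 𝒵 𝒰) {γ : ℝ} (hγ : 0 < γ) {n : ℕ} (hn : n ≠ 0) :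
    ∃ c : Code 𝒳 𝒴 𝒵 n,
      (X n).toOuterMeasure {x | D₁ + γ < d₁ n x (c.φ₁ (c.f₁ x)) ∨
        D₂ + γ < d₂ n x (c.φ₂ (c.f₁ x) (c.f₂ x))} ≤ excessBound X d₁ d₂ D₁ D₂ R₁ R₂ W γ n ∧
      1 / (n : ℝ) * Real.log c.M₁ ≤ R₁ + 2 * γ + Real.log 2 / n ∧
      1 / (n : ℝ) * Real.log c.M₂ ≤ R₂ + 2 * γ + Real.log 2 / n := by
  classical
  set M₁ := ⌈Real.exp (n * (R₁ + 2 * γ))⌉₊ with hM₁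
  set M₂ := ⌈Real.exp (n * (R₂ + 2 * γ))⌉₊ with hM₂
  have hM₁0 : 0 < M₁ := Nat.ceil_pos.2 (Real.exp_pos _)
  have hM₂0 : 0 < M₂ := Nat.ceil_pos.2 (Real.exp_pos _)
  set G : Set ((Fin n → 𝒵) × (Fin n → 𝒳) × (Fin n → 𝒰) × (Fin n → 𝒴)) :=
    {t | (d₁ n t.2.1 t.2.2.2 : ℝ) ≤ D₁ + γ ∧ (d₂ n t.2.1 t.1 : ℝ) ≤ D₂ + γ} with hG
  obtain ⟨v, z, h⟩ := exists_codebook (jointLaw X W n) Prod.fst (fun ω => (ω.2.1, ω.2.2.1))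
    (fun ω => ω.2.2.2) G (K₁ := Real.exp (n * (R₁ + γ))) (K₂ := Real.exp (n * (R₂ + γ)))
    (Real.one_le_exp (by positivity)) (Real.one_le_exp (by positivity)) M₁ M₂
  rw [map_fst_jointLaw] at h
  -- the encoders look for a good pair of codewords, and fall back on an arbitrary one
  set e : (Fin n → 𝒳) → Fin M₁ × Fin M₂ := fun x =>
    if hx : ∃ ij : Fin M₁ × Fin M₂, (z ij.1 ij.2, x, v ij.1) ∈ G then hx.choose
    else (⟨0, hM₁0⟩, ⟨0, hM₂0⟩) with he
  refine ⟨⟨M₁, M₂, hM₁0, hM₂0, fun x => (e x).1, fun x => (e x).2, fun i => (v i).2, z⟩,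
    ?_, log_natCeil_exp_le hn (by positivity), log_natCeil_exp_le hn (by positivity)⟩
  refine ((MeasureTheory.OuterMeasure.mono _ ?_).trans h).trans ?_
  · intro x hx i j hij
    have hex : ∃ ij : Fin M₁ × Fin M₂, (z ij.1 ij.2, x, v ij.1) ∈ G := ⟨(i, j), hij⟩
    have hgood : (z (e x).1 (e x).2, x, v (e x).1) ∈ G := by
      simp only [he, dif_pos hex]
      exact hex.choose_spec
    rcases hx with hx | hx
    · exact absurd hgood.1 (not_le.2 hx)
    · exact absurd hgood.2 (not_le.2 hx)
  · rw [excessBound]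
    gcongr ?_ + ?_ + ?_ + ENNReal.ofReal ?_ + ENNReal.ofReal ?_
    · refine (MeasureTheory.OuterMeasure.mono _ ?_).trans (MeasureTheory.measure_union_le _ _)
      intro ω hω
      by_contra hcon
      simp only [Set.mem_union, Set.mem_ofPred_eq, not_or, not_lt] at hcon
      exact hω hcon
    · exact MeasureTheory.OuterMeasure.mono _ fun ω hω => lt_one_div_mul_log_of_exp_lt hn hω
    · exact MeasureTheory.OuterMeasure.mono _ fun ω hω => lt_one_div_mul_log_of_exp_lt hn hω
    · exact exp_neg_natCeil_div_le n R₁ γ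
    · exact exp_neg_natCeil_div_le n R₂ γ

/-- A diagonal argument: the row may grow with the column while the entries still tend to zero. -/
lemma exists_tendsto_diagonal {F : ℕ → ℕ → ℝ≥0∞} (h : ∀ k, Tendsto (F k) atTop (𝓝 0)) :
    ∃ k : ℕ → ℕ, Tendsto k atTop atTop ∧ Tendsto (fun n => F (k n) n) atTop (𝓝 0) := by
  classical
  have hev : ∀ k : ℕ, ∀ᶠ n in atTop, F k n ≤ ((k + 1 : ℕ) : ℝ≥0∞)⁻¹ := fun k =>
    (h k).eventually_le_const (ENNReal.inv_pos.2 (ENNReal.natCast_ne_top _))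
  set k : ℕ → ℕ := fun n => Nat.findGreatest (fun k => F k n ≤ ((k + 1 : ℕ) : ℝ≥0∞)⁻¹) n with hk
  have hktop : Tendsto k atTop atTop := by
    refine tendsto_atTop.2 fun m => ?_
    filter_upwards [hev m, eventually_ge_atTop m] with n h1 h2
    exact Nat.le_findGreatest h2 h1
  refine ⟨k, hktop, ?_⟩
  have hlim : Tendsto (fun n => ((k n + 1 : ℕ) : ℝ≥0∞)⁻¹) atTop (𝓝 0) :=
    ENNReal.tendsto_inv_nat_nhds_zero.comp ((tendsto_add_atTop_nat 1).comp hktop)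
  refine tendsto_of_tendsto_of_tendsto_of_le_of_le' tendsto_const_nhds hlim
    (Eventually.of_forall fun _ => zero_le) ?_
  filter_upwards [hev 0] with n hn
  exact Nat.findGreatest_spec (P := fun k => F k n ≤ ((k + 1 : ℕ) : ℝ≥0∞)⁻¹) (Nat.zero_le n) hn

lemma tendsto_ofReal_exp_neg_exp {γ : ℝ} (hγ : 0 < γ) :
    Tendsto (fun n : ℕ => ENNReal.ofReal (Real.exp (-Real.exp (n * γ)))) atTop (𝓝 0) := by
  rw [← ENNReal.ofReal_zero]
  refine ENNReal.tendsto_ofReal (Real.tendsto_exp_neg_atTop_nhds_zero.comp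
    (Real.tendsto_exp_atTop.comp ?_))
  exact tendsto_natCast_atTop_atTop.atTop_mul_const hγ

lemma limsup_coe_le_of_le_of_tendsto {f g : ℕ → ℝ} {R : ℝ} (h : ∀ n, f n ≤ g n)
    (hg : Tendsto g atTop (𝓝 R)) : limsup (fun n => (f n : EReal)) atTop ≤ (R : EReal) := by
  rw [← ((continuous_coe_real_ereal.tendsto R).comp hg).limsup_eq]
  exact limsup_le_limsup (Eventually.of_forall fun n => EReal.coe_le_coe_iff.2 (h n))

theorem fmAchievable_of_mem_generalRegion (X : GeneralSource 𝒳) (d₁ : DistortionMeasures 𝒳 𝒴)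
    (d₂ : DistortionMeasures 𝒳 𝒵) {D₁ D₂ R₁ R₂ : ℝ} (hR₁ : 0 ≤ R₁) (hR₂ : 0 ≤ R₂)
    {W : CondLaws 𝒳 𝒴 𝒵 𝒰} (hW : W ∈ admissible 𝒰 X d₁ d₂ D₁ D₂)
    (hR : (R₁, R₂) ∈ generalRegion X W) : FmAchievable X d₁ d₂ D₁ D₂ R₁ R₂ := by
  have hγ : ∀ k : ℕ, (0 : ℝ) < 1 / (k + 1) := fun k => Nat.one_div_pos_of_nat
  have hF : ∀ k : ℕ, Tendsto (excessBound X d₁ d₂ D₁ D₂ R₁ R₂ W (1 / (k + 1))) atTop (𝓝 0) := by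
    intro k
    have h1 := pLimsup_le_iff.1 hW.1 _ (hγ k)
    have h2 := pLimsup_le_iff.1 hW.2 _ (hγ k)
    have h3 := pLimsup_le_iff.1 hR.1 _ (hγ k)
    have h4 := pLimsup_le_iff.1 hR.2 _ (hγ k)
    have h5 := tendsto_ofReal_exp_neg_exp (hγ k)
    have h := ((((h1.add h2).add h3).add h4).add h5).add h5
    simp only [add_zero] at h
    exact h
  obtain ⟨k, hk, hFk⟩ := exists_tendsto_diagonal hF
  have hslack : Tendsto (fun n => 1 / ((k n : ℝ) + 1)) atTop (𝓝 0) :=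
    tendsto_one_div_add_atTop_nhds_zero_nat.comp hk
  have hcode : ∀ n : ℕ, ∃ c : Code 𝒳 𝒴 𝒵 n,
      (n ≠ 0 → (X n).toOuterMeasure {x | D₁ + 1 / (k n + 1) < d₁ n x (c.φ₁ (c.f₁ x)) ∨
        D₂ + 1 / (k n + 1) < d₂ n x (c.φ₂ (c.f₁ x) (c.f₂ x))} ≤
          excessBound X d₁ d₂ D₁ D₂ R₁ R₂ W (1 / (k n + 1)) n) ∧
      1 / (n : ℝ) * Real.log c.M₁ ≤ R₁ + 2 * (1 / (k n + 1)) + Real.log 2 / n ∧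
      1 / (n : ℝ) * Real.log c.M₂ ≤ R₂ + 2 * (1 / (k n + 1)) + Real.log 2 / n := by
    intro n
    rcases eq_or_ne n 0 with rfl | hn
    · -- the words of length zero carry no constraint, so any code will do
      have := hγ (k 0)
      refine ⟨⟨1, 1, one_pos, one_pos, fun _ => 0, fun _ => 0, fun _ => Fin.elim0,
        fun _ _ => Fin.elim0⟩, fun h => absurd rfl h, ?_, ?_⟩ <;> simp <;> positivity
    · obtain ⟨c, h1, h2⟩ := exists_code X d₁ d₂ D₁ D₂ hR₁ hR₂ W (hγ (k n)) hn
      exact ⟨c, fun _ => h1, h2⟩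
  choose c hc hc₁ hc₂ using hcode
  have hrate : ∀ R : ℝ, Tendsto (fun n : ℕ => R + 2 * (1 / ((k n : ℝ) + 1)) + Real.log 2 / n)
      atTop (𝓝 R) := by
    intro R
    have h := ((hslack.const_mul 2).const_add R).add
      (tendsto_const_div_atTop_nhds_zero_nat (Real.log 2))
    simpa using h
  -- excess of a fixed slack `γ` is eventually covered by the vanishing slack `1 / (k n + 1)`
  have hdist : ∀ γ > 0, ∀ S : ∀ n, Set (Fin n → 𝒳),
      (∀ n, 1 / ((k n : ℝ) + 1) ≤ γ → S n ⊆
        {x | D₁ + 1 / (k n + 1) < d₁ n x ((c n).φ₁ ((c n).f₁ x)) ∨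
          D₂ + 1 / (k n + 1) < d₂ n x ((c n).φ₂ ((c n).f₁ x) ((c n).f₂ x))}) →
      Tendsto (fun n => (X n).toOuterMeasure (S n)) atTop (𝓝 0) := by
    intro γ hγ S hS
    refine tendsto_of_tendsto_of_tendsto_of_le_of_le' tendsto_const_nhds hFk
      (Eventually.of_forall fun _ => zero_le) ?_
    filter_upwards [eventually_ne_atTop 0, hslack.eventually_le_const hγ] with n hn hle
    exact (MeasureTheory.OuterMeasure.mono _ (hS n hle)).trans (hc n hn)
  refine ⟨c, pLimsup_le_iff.2 fun γ hγ => hdist γ hγ _ fun n hle x hx => Or.inl ?_,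
    pLimsup_le_iff.2 fun γ hγ => hdist γ hγ _ fun n hle x hx => Or.inr ?_,
    limsup_coe_le_of_le_of_tendsto hc₁ (hrate R₁), limsup_coe_le_of_le_of_tendsto hc₂ (hrate R₂)⟩
  · exact lt_of_le_of_lt (by linarith) hx
  · exact lt_of_le_of_lt (by linarith) hx

end Achievability

/-! ### Information rates through conditional laws -/

section Rates

variable {Ω α β γ : Type*}

lemma isCondLaw_const_unit (P : PMF Ω) (B : Ω → β) :
    IsCondLaw P B (fun _ => ()) fun _ => P.map B := by
  classical
  rintro ⟨⟩ b
  have h : P.map (fun _ => ()) = PMF.pure () := PMF.map_const _ _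
  rw [h, PMF.pure_apply, if_pos rfl, one_mul, PMF.map_apply, PMF.map_apply]
  simp

lemma toOuterMeasure_congr_support {P : PMF Ω} {S T : Set Ω}
    (h : ∀ ω ∈ P.support, ω ∈ S ↔ ω ∈ T) : P.toOuterMeasure S = P.toOuterMeasure T :=
  le_antisymm (PMF.toOuterMeasure_mono _ fun ω hω => (h ω hω.2).1 hω.1)
    (PMF.toOuterMeasure_mono _ fun ω hω => (h ω hω.2).2 hω.1)

lemma pLimsup_congr {Ω : ℕ → Type*} {P : ∀ n, PMF (Ω n)} {S S' : ∀ n, Ω n → ℝ}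
    (h : ∀ n, ∀ ω ∈ (P n).support, S n ω = S' n ω) : pLimsup P S = pLimsup P S' := by
  have key : ∀ n (α : ℝ), (P n).toOuterMeasure {ω | α < S n ω} =
      (P n).toOuterMeasure {ω | α < S' n ω} := fun n α =>
    toOuterMeasure_congr_support fun ω hω => by simp [h n ω hω]
  simp only [pLimsup, key]

lemma pLimsup_map {Ω Ω' : ℕ → Type*} (P : ∀ n, PMF (Ω n)) (g : ∀ n, Ω n → Ω' n)
    (S : ∀ n, Ω' n → ℝ) :
    pLimsup (fun n => (P n).map (g n)) S = pLimsup P fun n ω => S n (g n ω) := by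
  simp only [pLimsup, PMF.toOuterMeasure_map_apply, Set.preimage_ofPred_eq]

/-- The normalised log-likelihood ratio of two conditional laws of `B`, given `A` and given `C`. -/
noncomputable def infoDensity (n : ℕ) (κ' : α → PMF β) (A : Ω → α) (κ : γ → PMF β) (C : Ω → γ)
    (B : Ω → β) (ω : Ω) : ℝ :=
  (1 / (n : ℝ)) * Real.log ((κ' (A ω) (B ω)).toReal / (κ (C ω) (B ω)).toReal)

lemma supCondInfoRate_eq {Ω α β γ : ℕ → Type*} {P : ∀ n, PMF (Ω n)} {A : ∀ n, Ω n → α n}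
    {B : ∀ n, Ω n → β n} {C : ∀ n, Ω n → γ n} {κ' : ∀ n, α n × γ n → PMF (β n)}
    {κ : ∀ n, γ n → PMF (β n)}
    (hκ' : ∀ n, IsCondLaw (P n) (B n) (fun ω => (A n ω, C n ω)) (κ' n))
    (hκ : ∀ n, IsCondLaw (P n) (B n) (C n) (κ n)) :
    supCondInfoRate P A B C =
      pLimsup P fun n => infoDensity n (κ' n) (fun ω => (A n ω, C n ω)) (κ n) (C n) (B n) :=
  pLimsup_congr fun n ω hω => by
    rw [(hκ' n).condProb_eq (map_apply_ne_zero _ (fun ω => (A n ω, C n ω)) hω),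
      (hκ n).condProb_eq (map_apply_ne_zero _ _ hω), infoDensity]

lemma supInfoRate_eq {Ω α β : ℕ → Type*} {P : ∀ n, PMF (Ω n)} {A : ∀ n, Ω n → α n}
    {B : ∀ n, Ω n → β n} {κ' : ∀ n, α n → PMF (β n)}
    (hκ' : ∀ n, IsCondLaw (P n) (B n) (A n) (κ' n)) :
    supInfoRate P A B = pLimsup P fun n =>
      infoDensity n (κ' n) (A n) (fun _ => (P n).map (B n)) (fun _ => ()) (B n) :=
  pLimsup_congr fun n ω hω => by
    rw [(hκ' n).condProb_eq (map_apply_ne_zero _ _ hω), infoDensity, prob]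

/-! ### Non-negativity of the information rates -/

/-- A likelihood ratio is at most `δ` with probability at most `δ`. -/
lemma IsCondLaw.toOuterMeasure_le_mul {P : PMF Ω} {B : Ω → β} {A : Ω → α} {κ' : α → PMF β}
    (h : IsCondLaw P B A κ') (κ : α → PMF β) (δ : ℝ≥0∞) :
    P.toOuterMeasure {ω | κ' (A ω) (B ω) ≤ δ * κ (A ω) (B ω)} ≤ δ := by
  change P.toOuterMeasure {ω | (B ω, A ω) ∈ {t : β × α | κ' t.2 t.1 ≤ δ * κ t.2 t.1}} ≤ δ
  rw [toOuterMeasure_preimage_eq P (fun ω => (B ω, A ω)), h.tsum_mul]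
  calc _ ≤ ∑' a, P.map A a * ∑' b, δ * κ a b := by
        refine ENNReal.tsum_le_tsum fun a => ?_
        refine mul_le_mul' le_rfl (ENNReal.tsum_le_tsum fun b => ?_)
        by_cases hb : κ' a b ≤ δ * κ a b
        · rwa [Set.indicator_of_mem (by exact hb), Pi.one_apply, mul_one]
        · rw [Set.indicator_of_notMem (by exact hb), mul_zero]
          exact zero_le
    _ = δ := by
        simp only [ENNReal.tsum_mul_left, PMF.tsum_coe, mul_one]
        rw [ENNReal.tsum_mul_right, PMF.tsum_coe, one_mul]

lemma toReal_apply_pos {P : PMF Ω} {B : Ω → β} {A : Ω → α} {κ : α → PMF β}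
    (h : IsCondLaw P B A κ) {ω : Ω} (hω : ω ∈ P.support) : 0 < (κ (A ω) (B ω)).toReal :=
  ENNReal.toReal_pos (h.apply_ne_zero hω) (PMF.apply_ne_top _ _)

lemma tendsto_ofReal_exp_neg_mul {ε : ℝ} (hε : 0 < ε) :
    Tendsto (fun n : ℕ => ENNReal.ofReal (Real.exp (-(n * ε)))) atTop (𝓝 0) := by
  rw [← ENNReal.ofReal_zero]
  exact ENNReal.tendsto_ofReal (Real.tendsto_exp_neg_atTop_nhds_zero.comp
    (tendsto_natCast_atTop_atTop.atTop_mul_const hε))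

/-- The spectral rate is non-negative whenever `C` is a function of `A`. -/
lemma nonneg_of_pLimsup_infoDensity_le {Ω α β γ : ℕ → Type*} {P : ∀ n, PMF (Ω n)}
    {A : ∀ n, Ω n → α n} {B : ∀ n, Ω n → β n} {κ' : ∀ n, α n → PMF (β n)}
    {κ : ∀ n, γ n → PMF (β n)} (g : ∀ n, α n → γ n)
    (hκ' : ∀ n, IsCondLaw (P n) (B n) (A n) (κ' n))
    (hκ : ∀ n, IsCondLaw (P n) (B n) (fun ω => g n (A n ω)) (κ n)) {R : ℝ}
    (hR : pLimsup P (fun n => infoDensity n (κ' n) (A n) (κ n) (fun ω => g n (A n ω)) (B n)) ≤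
      (R : EReal)) : 0 ≤ R := by
  by_contra! hneg
  have h1 := pLimsup_le_iff.1 hR (-(R / 2)) (by linarith)
  have h2 : Tendsto (fun n => (P n).toOuterMeasure {ω | infoDensity n (κ' n) (A n) (κ n)
      (fun ω => g n (A n ω)) (B n) ω ≤ R + -(R / 2)}) atTop (𝓝 0) := by
    refine tendsto_of_tendsto_of_tendsto_of_le_of_le' tendsto_const_nhds
      (tendsto_ofReal_exp_neg_mul (ε := -(R / 2)) (by linarith))
      (Eventually.of_forall fun _ => zero_le) ?_
    filter_upwards [eventually_ne_atTop 0] with n hn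
    have hn' : (0 : ℝ) < n := by positivity
    refine (PMF.toOuterMeasure_mono _ ?_).trans
      ((hκ' n).toOuterMeasure_le_mul (fun a => κ n (g n a)) _)
    rintro ω ⟨hω, hsupp⟩
    have ha := toReal_apply_pos (hκ' n) hsupp
    have hb := toReal_apply_pos (hκ n) hsupp
    have hle : Real.log ((κ' n (A n ω) (B n ω)).toReal / (κ n (g n (A n ω)) (B n ω)).toReal) ≤
        -(n * -(R / 2)) := by
      have : 1 / (n : ℝ) * _ ≤ _ := hω
      rw [one_div, inv_mul_eq_div, div_le_iff₀ hn'] at this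
      linarith
    rw [Real.log_le_iff_le_exp (div_pos ha hb), div_le_iff₀ hb] at hle
    change κ' n (A n ω) (B n ω) ≤ _ * κ n (g n (A n ω)) (B n ω)
    rw [← ENNReal.ofReal_toReal (PMF.apply_ne_top (κ' n (A n ω)) (B n ω)),
      ← ENNReal.ofReal_toReal (PMF.apply_ne_top (κ n (g n (A n ω))) (B n ω)),
      ← ENNReal.ofReal_mul (Real.exp_nonneg _)]
    exact ENNReal.ofReal_le_ofReal hle
  have h3 : ∀ n, (1 : ℝ≥0∞) ≤ (P n).toOuterMeasure {ω | R + -(R / 2) < infoDensity n (κ' n) (A n)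
      (κ n) (fun ω => g n (A n ω)) (B n) ω} + (P n).toOuterMeasure {ω | infoDensity n (κ' n) (A n)
      (κ n) (fun ω => g n (A n ω)) (B n) ω ≤ R + -(R / 2)} := by
    intro n
    rw [← ((P n).toOuterMeasure_apply_eq_one_iff Set.univ).2 (Set.subset_univ _)]
    refine le_trans (MeasureTheory.OuterMeasure.mono _ fun ω _ => ?_)
      (MeasureTheory.measure_union_le _ _)
    exact lt_or_ge (R + -(R / 2)) _
  -- the two events cover the whole space, but both probabilities vanish
  have h4 := ge_of_tendsto' (h1.add h2) h3
  simp at h4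

/-! ### Rate bounds for quantised variables -/

/-- If `B` takes at most `M` values once `A` is given, then its conditional probability is at most
`δ` with probability at most `M δ`. -/
lemma IsCondLaw.toOuterMeasure_le_natCast_mul {P : PMF Ω} {B : Ω → β} {A : Ω → α} {κ : α → PMF β}
    (h : IsCondLaw P B A κ) {M : ℕ} (ψ : α → Fin M → β)
    (hψ : ∀ ω ∈ P.support, ∃ j, B ω = ψ (A ω) j) (δ : ℝ≥0∞) :
    P.toOuterMeasure {ω | κ (A ω) (B ω) ≤ δ} ≤ M * δ := by
  classical
  calc P.toOuterMeasure {ω | κ (A ω) (B ω) ≤ δ}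
      ≤ P.toOuterMeasure {ω | (B ω, A ω) ∈ {t : β × α | κ t.2 t.1 ≤ δ ∧ ∃ j, t.1 = ψ t.2 j}} :=
        PMF.toOuterMeasure_mono _ fun ω hω => ⟨hω.1, hψ ω hω.2⟩
    _ = ∑' a, P.map A a * ∑' b, κ a b *
          {t : β × α | κ t.2 t.1 ≤ δ ∧ ∃ j, t.1 = ψ t.2 j}.indicator 1 (b, a) := by
        rw [toOuterMeasure_preimage_eq P (fun ω => (B ω, A ω)), h.tsum_mul]
    _ ≤ ∑' a, P.map A a * ∑' b, ∑ j, if b = ψ a j then δ else 0 := by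
        refine ENNReal.tsum_le_tsum fun a => ?_
        refine mul_le_mul' le_rfl (ENNReal.tsum_le_tsum fun b => ?_)
        by_cases hb : κ a b ≤ δ ∧ ∃ j, b = ψ a j
        · rw [Set.indicator_of_mem (by exact hb), Pi.one_apply, mul_one]
          obtain ⟨h1, j, hj⟩ := hb
          refine h1.trans ?_
          refine le_trans (by rw [if_pos hj]) (Finset.single_le_sum
            (f := fun j => if b = ψ a j then δ else 0) (fun _ _ => zero_le) (Finset.mem_univ j))
        · rw [Set.indicator_of_notMem (by exact hb), mul_zero]
          exact zero_le
    _ = M * δ := by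
        have : ∀ a, (∑' b, ∑ j, if b = ψ a j then δ else 0) = M * δ := fun a => by
          rw [Summable.tsum_finsetSum fun _ _ => ENNReal.summable]
          simp
        simp only [this]
        rw [ENNReal.tsum_mul_right, PMF.tsum_coe, one_mul]

/-- If `B` takes at most `M n` values once `C` is given, the spectral rate of `B` relative to `C` is
at most the exponential growth rate of `M n`. -/
lemma pLimsup_infoDensity_le {Ω α β γ : ℕ → Type*} {P : ∀ n, PMF (Ω n)}
    {A : ∀ n, Ω n → α n} {B : ∀ n, Ω n → β n} {C : ∀ n, Ω n → γ n} {κ' : ∀ n, α n → PMF (β n)}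
    {κ : ∀ n, γ n → PMF (β n)}
    (hκ' : ∀ n, IsCondLaw (P n) (B n) (A n) (κ' n))
    (hκ : ∀ n, IsCondLaw (P n) (B n) (C n) (κ n)) {M : ℕ → ℕ} (hM : ∀ n, 0 < M n)
    (ψ : ∀ n, γ n → Fin (M n) → β n)
    (hψ : ∀ n, ∀ ω ∈ (P n).support, ∃ j, B n ω = ψ n (C n ω) j) {R : ℝ}
    (hR : limsup (fun n : ℕ => (((1 / (n : ℝ)) * Real.log (M n : ℝ) : ℝ) : EReal)) atTop
      ≤ (R : EReal)) :
    pLimsup P (fun n => infoDensity n (κ' n) (A n) (κ n) (C n) (B n)) ≤ (R : EReal) := by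
  refine pLimsup_le_iff.2 fun ε hε => ?_
  refine tendsto_of_tendsto_of_tendsto_of_le_of_le' tendsto_const_nhds
    (tendsto_ofReal_exp_neg_mul (half_pos hε)) (Eventually.of_forall fun _ => zero_le) ?_
  have hlt : (R : EReal) < ((R + ε / 2 : ℝ) : EReal) := EReal.coe_lt_coe_iff.2 (by linarith)
  filter_upwards [eventually_ne_atTop 0, eventually_lt_of_limsup_lt (hR.trans_lt hlt)] with n hn hMn
  have hn' : (0 : ℝ) < n := by positivity
  have hM' : (0 : ℝ) < M n := Nat.cast_pos.2 (hM n)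
  have hMexp : (M n : ℝ) ≤ Real.exp (n * (R + ε / 2)) := by
    have := (EReal.coe_lt_coe_iff.1 hMn).le
    rw [one_div, inv_mul_eq_div, div_le_iff₀ hn'] at this
    rw [← Real.log_le_iff_le_exp hM']
    linarith
  calc (P n).toOuterMeasure {ω | R + ε < infoDensity n (κ' n) (A n) (κ n) (C n) (B n) ω}
      ≤ (P n).toOuterMeasure
          {ω | κ n (C n ω) (B n ω) ≤ ENNReal.ofReal (Real.exp (-(n * (R + ε))))} := by
        refine PMF.toOuterMeasure_mono _ ?_
        rintro ω ⟨hω, hsupp⟩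
        have ha := toReal_apply_pos (hκ' n) hsupp
        have hb := toReal_apply_pos (hκ n) hsupp
        have ha1 : (κ' n (A n ω) (B n ω)).toReal ≤ 1 :=
          ENNReal.toReal_le_of_le_ofReal zero_le_one (by simpa using PMF.coe_le_one _ _)
        have hlt : R + ε < 1 / (n : ℝ) * _ := hω
        rw [one_div, inv_mul_eq_div, lt_div_iff₀ hn',
          Real.lt_log_iff_exp_lt (div_pos ha hb), lt_div_iff₀ hb, mul_comm (R + ε)] at hlt
        change κ n (C n ω) (B n ω) ≤ _
        rw [← ENNReal.ofReal_toReal (PMF.apply_ne_top (κ n (C n ω)) (B n ω))]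
        refine ENNReal.ofReal_le_ofReal ?_
        rw [Real.exp_neg, ← one_div, le_div_iff₀ (Real.exp_pos _)]
        linarith
    _ ≤ M n * ENNReal.ofReal (Real.exp (-(n * (R + ε)))) :=
        (hκ n).toOuterMeasure_le_natCast_mul (ψ n) (hψ n) _
    _ ≤ ENNReal.ofReal (Real.exp (-(n * (ε / 2)))) := by
        rw [← ENNReal.ofReal_natCast, ← ENNReal.ofReal_mul hM'.le]
        refine ENNReal.ofReal_le_ofReal ?_
        calc (M n : ℝ) * Real.exp (-(n * (R + ε)))
            ≤ Real.exp (n * (R + ε / 2)) * Real.exp (-(n * (R + ε))) := by gcongr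
          _ = Real.exp (-(n * (ε / 2))) := by rw [← Real.exp_add]; congr 1; ring

end Rates

/-! ### The two inclusions -/

section Region

variable {𝒳 𝒴 𝒵 𝒰 : Type*}

lemma nonneg_of_mem_generalRegion {X : GeneralSource 𝒳} {W : CondLaws 𝒳 𝒴 𝒵 𝒰} {R : ℝ × ℝ}
    (hR : R ∈ generalRegion X W) : 0 ≤ R.1 ∧ 0 ≤ R.2 := by
  obtain ⟨h1, h2⟩ := hR
  choose W₁ hW₁ using fun n => exists_isCondLaw (jointLaw X W n) (fun ω => (ω.2.1, ω.2.2.1))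
    (fun ω => ω.1)
  choose W₂ hW₂ using fun n => exists_isCondLaw (jointLaw X W n) (fun ω => ω.2.2.2)
    (fun ω => (ω.1, ω.2.1, ω.2.2.1))
  choose W₃ hW₃ using fun n => exists_isCondLaw (jointLaw X W n) (fun ω => ω.2.2.2)
    (fun ω => (ω.2.1, ω.2.2.1))
  rw [supInfoRate_eq hW₁] at h1
  rw [supCondInfoRate_eq hW₂ hW₃] at h2
  constructor
  · exact nonneg_of_pLimsup_infoDensity_le (P := jointLaw X W) (A := fun _ ω => ω.1)
      (B := fun _ ω => (ω.2.1, ω.2.2.1)) (γ := fun _ => Unit) (fun _ _ => ()) hW₁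
      (fun n => isCondLaw_const_unit _ _) h1
  · exact nonneg_of_pLimsup_infoDensity_le (P := jointLaw X W)
      (A := fun _ ω => (ω.1, ω.2.1, ω.2.2.1)) (B := fun _ ω => ω.2.2.2) (fun _ t => t.2)
      hW₂ hW₃ h2

/-- The converse: the auxiliary sequence is an injective image of a source sequence chosen to
represent the first codeword, so that it determines that codeword and is determined by it. -/
theorem exists_mem_generalRegion_of_fmAchievable [Nonempty (𝒳 ↪ 𝒰)] (X : GeneralSource 𝒳)
    (d₁ : DistortionMeasures 𝒳 𝒴) (d₂ : DistortionMeasures 𝒳 𝒵) {D₁ D₂ R₁ R₂ : ℝ}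
    (h : FmAchievable X d₁ d₂ D₁ D₂ R₁ R₂) :
    ∃ W ∈ admissible 𝒰 X d₁ d₂ D₁ D₂, (R₁, R₂) ∈ generalRegion X W := by
  obtain ⟨c, hD₁, hD₂, hM₁, hM₂⟩ := h
  obtain ⟨e⟩ := ‹Nonempty (𝒳 ↪ 𝒰)›
  have : ∀ n, Nonempty (Fin n → 𝒳) := fun n => (X n).support_nonempty.to_type
  set E : ∀ n, (Fin n → 𝒳) → (Fin n → 𝒰) := fun n x i => e (x i) with hE
  have hEinj : ∀ n, Function.Injective (E n) := fun n x x' h =>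
    funext fun i => e.injective (congrFun h i)
  set u : ∀ n, Fin (c n).M₁ → (Fin n → 𝒰) := fun n m => E n (Function.invFun (c n).f₁ m) with hu
  -- the first codeword can be read off from `u`
  have hdec : ∀ n x, (c n).f₁ (Function.invFun (E n) (u n ((c n).f₁ x))) = (c n).f₁ x := by
    intro n x
    rw [hu, Function.leftInverse_invFun (hEinj n)]
    exact Function.invFun_eq ⟨x, rfl⟩
  set g : ∀ n, (Fin n → 𝒳) → (Fin n → 𝒳) × (Fin n → 𝒰) × (Fin n → 𝒴) × (Fin n → 𝒵) := fun n x =>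
    (x, u n ((c n).f₁ x), (c n).φ₁ ((c n).f₁ x), (c n).φ₂ ((c n).f₁ x) ((c n).f₂ x)) with hg
  set W : CondLaws 𝒳 𝒴 𝒵 𝒰 := fun n x => PMF.pure (g n x).2 with hW
  have hJ : jointLaw X W = fun n => (X n).map (g n) := by
    funext n
    simp only [jointLaw, hW, PMF.pure_map]
    rfl
  have hsupp : ∀ n, ∀ ω ∈ (jointLaw X W n).support, ∃ x, g n x = ω := by
    intro n ω hω
    rw [hJ] at hω
    obtain ⟨x, -, hx⟩ := (PMF.mem_support_map_iff _ _ _).1 hω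
    exact ⟨x, hx⟩
  refine ⟨W, ⟨?_, ?_⟩, ?_, ?_⟩
  · rw [hJ, pLimsup_map]
    exact hD₁
  · rw [hJ, pLimsup_map]
    exact hD₂
  · choose W₁ hW₁ using fun n => exists_isCondLaw (jointLaw X W n) (fun ω => (ω.2.1, ω.2.2.1))
      (fun ω => ω.1)
    rw [supInfoRate_eq hW₁]
    refine pLimsup_infoDensity_le hW₁ (fun n => isCondLaw_const_unit _ _)
      (fun n => (c n).M₁_pos) (fun n _ m => (u n m, (c n).φ₁ m)) (fun n ω hω => ?_) hM₁
    obtain ⟨x, rfl⟩ := hsupp n ω hω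
    exact ⟨(c n).f₁ x, rfl⟩
  · choose W₂ hW₂ using fun n => exists_isCondLaw (jointLaw X W n) (fun ω => ω.2.2.2)
      (fun ω => (ω.1, ω.2.1, ω.2.2.1))
    choose W₃ hW₃ using fun n => exists_isCondLaw (jointLaw X W n) (fun ω => ω.2.2.2)
      (fun ω => (ω.2.1, ω.2.2.1))
    rw [supCondInfoRate_eq hW₂ hW₃]
    refine pLimsup_infoDensity_le hW₂ hW₃ (fun n => (c n).M₂_pos)
      (fun n t m => (c n).φ₂ ((c n).f₁ (Function.invFun (E n) t.1)) m) (fun n ω hω => ?_) hM₂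
    obtain ⟨x, rfl⟩ := hsupp n ω hω
    refine ⟨(c n).f₂ x, ?_⟩
    simp only [hg, hdec]

end Region

end SuccessiveRefinement

theorem mainTheorem1 {𝒳 𝒴 𝒵 𝒰 : Type*} [Countable 𝒳] [Countable 𝒴] [Countable 𝒵] [Countable 𝒰]
    (hU : Nonempty (𝒳 ↪ 𝒰))
    (X : SuccessiveRefinement.GeneralSource 𝒳)
    (d₁ : SuccessiveRefinement.DistortionMeasures 𝒳 𝒴)
    (d₂ : SuccessiveRefinement.DistortionMeasures 𝒳 𝒵)
    (D₁ D₂ : ℝ) (hD₁ : 0 ≤ D₁) (hD₂ : 0 ≤ D₂) :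
    SuccessiveRefinement.rateDistortionRegion X d₁ d₂ D₁ D₂ =
      ⋃ W ∈ SuccessiveRefinement.admissible 𝒰 X d₁ d₂ D₁ D₂,
        SuccessiveRefinement.generalRegion X W := by
  ext ⟨R₁, R₂⟩
  simp only [Set.mem_iUnion, exists_prop]
  constructor
  · rintro ⟨-, -, h⟩
    exact SuccessiveRefinement.exists_mem_generalRegion_of_fmAchievable X d₁ d₂ h
  · rintro ⟨W, hW, hR⟩
    obtain ⟨h1, h2⟩ := SuccessiveRefinement.nonneg_of_mem_generalRegion hR
    exact ⟨h1, h2, SuccessiveRefinement.fmAchievable_of_mem_generalRegion X d₁ d₂ h1 h2 hW hR⟩
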